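/- Let $d\ge 1$ and let $B_r=\{u\in\mathbb{Z}^d:\sum_i|u_i|\le r\}$ be the ball of radius $r$ around the origin of the grid $\mathbb{Z}^d$ (edges oriented and labelled by the standard generators). An *LCL* on $\mathbb{Z}^d$ is a quadruple $\Pi=(\Sigma_{in},\Sigma_{out},t,\mathcal{P})$ where $\Sigma_{in},\Sigma_{out}$ are finite sets ($\Sigma_{in}\neq\emptyset$; a problem *without inputs* is one with $|\Sigma_{in}|=1$), $t\in\mathbb{N}$, and $\mathcal{P}$ is a set of labellings $B_t\to\Sigma_{in}\times\Sigma_{out}$. A labelling of $\mathbb{Z}^d$, or of a $d$-dimensional torus, by $\Sigma_{in}\times\Sigma_{out}$ is a *$\Pi$-coloring* if the labelled radius-$t$ neighbourhood of every vertex is in $\mathcal{P}$. *Uniform local algorithms.* A uniform local algorithm $\mathcal{A}$ is a partial measurable function from finite balls labelled by $\Sigma_{in}\times[0,1]$ to $\Sigma_{out}$. Run at a vertex $v$ of $\mathbb{Z}^d$ it scans the balls of radius $0,1,2,\dots$ around $v$ and outputs the value at the first one in its domain; the radius of that ball is the coding radius $R_{\mathcal{A}}$ at $v$ ($\infty$ if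 there is none). It solves $\Pi$ if, for every input labelling of $\mathbb{Z}^d$, for almost every i.i.d. uniform $[0,1]$-labelling, it gives an output at every vertex and input and output together form a $\Pi$-coloring. $\Pi\in\mathsf{ULOCAL}(t(\varepsilon))$ means that some uniform local algorithm solves $\Pi$ and satisfies $\sup P(R_{\mathcal{A}}>t(\varepsilon))\le\varepsilon$ for all $\varepsilon\in(0,1)$, where $R_{\mathcal{A}}$ is taken at the origin and the supremum is over all input labellings. $\Pi\in\mathsf{ULOCAL}(o(\log^*1/\varepsilon))$ means $\Pi\in\mathsf{ULOCAL}(t(\varepsilon))$ for some $t:\mathbb R\to\mathbb{N}$ with $t(\varepsilon)=o(\log^*(1/\varepsilon))$ as $\varepsilon\to0^+$, where $\log^*x$ is the least number of applications of $\log_2$ that bring $x$ to at most $1$. *Local algorithms.* $\Pi\in\mathsf{LOCAL}(f(n))$ means that for every $C\in\mathbb{N}$ there is a function $\mathcal{A}$ which takes $n$ and a ball of radius $f(n)$ labelled by identifiers from $\mathbb{N}$ and inputs from $\Sigma_{in}$ to an output in $\Sigma_{out}$, such that on every $d$-dimensional torus with $n$ vertices all of whose side lengths exceed $2f(n)$ and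 $2t$, for every assignment of unique identifiers from $\{1,\dots,n^C\}$ and every input labelling, applying $\mathcal{A}$ to the radius-$f(n)$ neighbourhood of every vertex yields a $\Pi$-coloring. $\Pi\in\mathsf{LOCAL}(O(1))$ means $\Pi\in\mathsf{LOCAL}(f(n))$ for some $f:\mathbb{N}\to\mathbb{N}$ with $f(n)=O(1)$. **Corollary.** If an LCL $\Pi$ on $\mathbb{Z}^d$ is in $\mathsf{ULOCAL}(o(\log^*1/\varepsilon))$, then $\Pi\in\mathsf{LOCAL}(O(1))$. If moreover $\Pi$ has no inputs, then $\Pi$ is trivial: there is $\alpha\in\Sigma_{out}$ such that the labelling of $\mathbb{Z}^d$ that is constantly $\alpha$ is a $\Pi$-coloring. (So no nontrivial LCL without inputs has sub-$\log^*$ uniform complexity, which answers Problem (ii) of Holroyd–Schramm–Wilson in the negative.) -/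

import Mathlib

open Filter Topology MeasureTheory Asymptotics

namespace GridLCL

/-! ### The iterated logarithm -/

/-- `log* x`: the number of times the base two logarithm has to be applied to `x` before the
result is at most one. -/
noncomputable def logStar (x : ℝ) : ℕ :=
  sInf {k : ℕ | (Real.logb 2)^[k] x ≤ 1}

/-- The set in the definition of `logStar` is never empty. -/
theorem exists_iterate_logb_le_one (x : ℝ) : ∃ k : ℕ, (Real.logb 2)^[k] x ≤ 1 := by
  have key : ∀ (n : ℕ) (y : ℝ), y ≤ n + 1 → ∃ k : ℕ, (Real.logb 2)^[k] y ≤ 1 := by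
    intro n
    induction n with
    | zero => intro y hy; exact ⟨0, by simpa using hy⟩
    | succ n ih =>
      intro y hy
      rcases le_or_gt y 1 with h1 | h1
      · exact ⟨0, by simpa using h1⟩
      rcases le_or_gt y 2 with h2 | h2
      · refine ⟨1, ?_⟩
        have : Real.logb 2 y ≤ Real.logb 2 2 :=
          Real.logb_le_logb_of_le (by norm_num) (by linarith) h2
        simpa using this
      · have hb : 1 + (y - 1) * 1 ≤ (1 + 1 : ℝ) ^ (y - 1) :=
          one_add_mul_self_le_rpow_one_add (by norm_num) (by linarith)
        have hl : Real.logb 2 y ≤ y - 1 := by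
          rw [Real.logb_le_iff_le_rpow (by norm_num) (by linarith)]
          norm_num at hb
          linarith
        push_cast at hy
        obtain ⟨k, hk⟩ := ih (Real.logb 2 y) (by linarith)
        exact ⟨k + 1, by simpa [Function.iterate_succ_apply] using hk⟩
  obtain ⟨n, hn⟩ := exists_nat_ge x
  exact key n x (by linarith)

/-! ### Grids, tori and rooted neighbourhoods -/

/-- The vertices of the grid `ℤ^d`, the Cayley graph for the standard generators. -/
abbrev Grid (d : ℕ) : Type := Fin d → ℤ

/-- The ball of radius `r` around the origin of `ℤ^d` for the graph distance, which is the
`ℓ¹`-distance. -/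
def ball (d r : ℕ) : Set (Grid d) :=
  {u | ∑ i, (u i).natAbs ≤ r}

/-- The vertices of the `d`-dimensional torus with side lengths `s 0, …, s (d - 1)`. -/
abbrev Torus {d : ℕ} (s : Fin d → ℕ) : Type := ∀ i, ZMod (s i)

/-- The covering of the torus by the grid. -/
def Torus.cover {d : ℕ} (s : Fin d → ℕ) (u : Grid d) : Torus s := fun i => (u i : ZMod (s i))

/-- The radius `r` neighbourhood of the vertex `v`, as a rooted grid with vertex labels, in a
graph with vertex set `V` and labels `c`. The graph is `ℤ^d` (with `π` the identity) or a torus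
(with `π` the covering map). Edges are oriented and labelled by the generators, so a rooted grid
has no automorphisms and a vertex of the neighbourhood is named by its displacement `u` from the
root. -/
def view {d : ℕ} {V α : Type*} [Add V] (π : Grid d → V) (r : ℕ) (c : V → α) (v : V) :
    ball d r → α :=
  fun u => c (v + π u)

/-! ### Locally checkable problems -/

/-- A locally checkable problem on `ℤ^d` with input labels from `In` and output labels from `Out`:
a radius `t` and a set of rooted grids of radius `t` each of whose vertices is labelled by an
input and an output. -/
structure LCL (d : ℕ) (In Out : Type*) where
  /-- The radius `t` of the constraints. -/
  radius : ℕ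
  /-- The allowed labelled rooted grids. -/
  allowed : Set (ball d radius → In × Out)

namespace LCL

variable {d : ℕ} {In Out : Type*}

/-- The input labelling `inp` and the output labelling `c` together form a solution: the
neighbourhood of every vertex is allowed. -/
def IsColoring (L : LCL d In Out) {V : Type*} [Add V] (π : Grid d → V) (inp : V → In)
    (c : V → Out) : Prop :=
  ∀ v, view π L.radius (fun w => (inp w, c w)) v ∈ L.allowed

/-- The problem is trivial: some constant labelling of `ℤ^d` is a solution (for every input,
if there is more than one). -/
def IsTrivial (L : LCL d In Out) : Prop :=
  ∃ a : Out, ∀ inp : Grid d → In, L.IsColoring id inp (fun _ => a)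

end LCL

/-! ### Deterministic local algorithms -/

/-- A deterministic local algorithm of local complexity `f`: it takes `n` and a rooted grid of
radius `f n` labelled by identifiers and inputs, and it gives the output of the root. -/
def LocalAlgorithm (d : ℕ) (In Out : Type*) (f : ℕ → ℕ) : Type _ :=
  ∀ n : ℕ, (ball d (f n) → ℕ) → (ball d (f n) → In) → Out

/-- `LOCAL(f)`. For every polynomial range `{1, …, n ^ C}` of the identifiers there is a
deterministic local algorithm of local complexity `f` that solves the problem, for all unique
identifiers from that range and all inputs, on every torus with `n` vertices that is wide enough
for the neighbourhoods of radius `f n` that the algorithm sees, and those of radius `t` that the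
problem looks at, to be grids. -/
def LCL.InLOCAL {d : ℕ} {In Out : Type*} (L : LCL d In Out) (f : ℕ → ℕ) : Prop :=
  ∀ C : ℕ, ∃ A : LocalAlgorithm d In Out f,
    ∀ (n : ℕ) (s : Fin d → ℕ), ∏ i, s i = n → (∀ i, 2 * f n < s i ∧ 2 * L.radius < s i) →
      ∀ ident : Torus s → ℕ, Function.Injective ident → (∀ v, ident v ∈ Finset.Icc 1 (n ^ C)) →
        ∀ inp : Torus s → In,
          L.IsColoring (Torus.cover s) inp fun v =>
            A n (view (Torus.cover s) (f n) ident v) (view (Torus.cover s) (f n) inp v)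

/-! ### Uniform local algorithms -/

/-- The law of an independent, uniformly distributed labelling of `ℤ^d` by reals from `[0, 1]`. -/
noncomputable def iid (d : ℕ) : Measure (Grid d → unitInterval) :=
  Measure.infinitePi fun _ => volume

/-- A uniform local algorithm: a partial measurable function from finite rooted grids, labelled by
inputs and random reals, to outputs. The value `none` means that the rooted grid is not in the
domain: the algorithm has to look further. As there are only finitely many inputs, measurability
is asked for one input pattern at a time. -/
structure UniformAlgorithm (d : ℕ) (In Out : Type*) where
  /-- The partial function, on rooted grids of radius `r`. -/
  rule : ∀ r : ℕ, (ball d r → In) → (ball d r → unitInterval) → Option Out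
  measurable_rule : ∀ (r : ℕ) (a : ball d r → In) (o : Out),
    MeasurableSet {x | rule r a x = some o}

namespace UniformAlgorithm

variable {d : ℕ} {In Out : Type*}

/-- What the algorithm, run at the vertex `v` of `ℤ^d`, does with the neighbourhood of
radius `r`. -/
def run (A : UniformAlgorithm d In Out) (inp : Grid d → In) (x : Grid d → unitInterval)
    (v : Grid d) (r : ℕ) : Option Out :=
  A.rule r (view id r inp v) (view id r x v)

/-- The coding radius at `v`: the least radius that suffices to give an output, infinite if there
is none. -/
noncomputable def codingRadius (A : UniformAlgorithm d In Out) (inp : Grid d → In)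
    (x : Grid d → unitInterval) (v : Grid d) : ℕ∞ :=
  sInf ((fun r : ℕ => (r : ℕ∞)) '' {r | (A.run inp x v r).isSome})

open Classical in
/-- The output at `v`: the algorithm scans larger and larger neighbourhoods of `v` and gives the
output that belongs to the first one in its domain. It is `none` if it never stops. -/
noncomputable def output (A : UniformAlgorithm d In Out) (inp : Grid d → In)
    (x : Grid d → unitInterval) (v : Grid d) : Option Out :=
  if h : ∃ r, (A.run inp x v r).isSome then A.run inp x v (Nat.find h) else none

/-- The algorithm solves the problem: for every input labelling of `ℤ^d`, almost surely, it gives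
an output at every vertex, and these outputs form a solution. -/
def Solves (A : UniformAlgorithm d In Out) (L : LCL d In Out) : Prop :=
  ∀ inp : Grid d → In, ∀ᵐ x ∂(iid d), ∃ c : Grid d → Out,
    (∀ v, A.output inp x v = some (c v)) ∧ L.IsColoring id inp c

/-- The probability that the coding radius exceeds `r`: the supremum of the probabilities for all
the input labellings. As all of these are considered, one root suffices. -/
noncomputable def tail (A : UniformAlgorithm d In Out) (r : ℕ) : ENNReal :=
  ⨆ inp : Grid d → In, iid d {x | (r : ℕ∞) < A.codingRadius inp x 0}

end UniformAlgorithm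

/-- `ULOCAL(t(ε))`: some uniform local algorithm solves the problem with uniform complexity `t`,
that is, the probability that it has to look further than `t ε` is at most `ε`. -/
def LCL.InULOCAL {d : ℕ} {In Out : Type*} (L : LCL d In Out) (t : ℝ → ℕ) : Prop :=
  ∃ A : UniformAlgorithm d In Out, A.Solves L ∧
    ∀ ε : ℝ, 0 < ε → ε < 1 → A.tail (t ε) ≤ ENNReal.ofReal ε

end GridLCL

open GridLCL

/-! Stop the uniform algorithm at radius T = t(ε). By a union bound over the constraint ball B_t,
the stopped algorithm violates the constraint at the origin with probability at most |B_t| ε, for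
every input. Names from ℤ^d can be given to the vertices in any injective way, and the random reals
attached to the names: this does not change their law. If 1/ε exceeds |B_t| times the number of
namings and local inputs under consideration, then one fixed labelling h of names by reals works for
all of them (`Solves.exists_goodAtOrigin`).

The namings come from sets S of numbers below N: the coordinates of a vertex name the hyperplanes
through it, increasingly along each block of S. A radius-T view near the origin is then determined
by the inputs and a k-subset of S with k = d(2T+1). Ramsey's theorem, with k-sets coloured by the
induced map from inputs to outputs, gives an S on which this map is a single F. Goodness of h for S
says that F solves the problem while ignoring all randomness (`Solves.exists_isObliviousRule`). Such
a rule works on all tori with constant radius, and it is constant if there is only one input.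

Naming hyperplanes instead of vertices makes k linear in T rather than of order T^d. The Ramsey
number is thus below a tower of height O(T), and t = o(log* 1/ε) provides an ε with 1/ε above that
tower. -/

namespace GridLCL

/-! ### Towers and the iterated logarithm -/

/-- The tower of `n` twos. -/
def tower : ℕ → ℕ
  | 0 => 1
  | n + 1 => 2 ^ tower n

theorem tower_mono : Monotone tower :=
  monotone_nat_of_le_succ fun _ => Nat.lt_two_pow_self.le

theorem le_tower (n : ℕ) : n ≤ tower n := by
  induction n with
  | zero => simp
  | succ n ih => exact lt_of_le_of_lt ih Nat.lt_two_pow_self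

theorem one_le_tower (n : ℕ) : 1 ≤ tower n := tower_mono (Nat.zero_le n)

theorem four_le_tower {s : ℕ} (hs : 2 ≤ s) : 4 ≤ tower s :=
  le_trans (by simp [tower]) (tower_mono hs)

theorem mul_self_le_two_pow {n : ℕ} (hn : 4 ≤ n) : n * n ≤ 2 ^ n := by
  induction n, hn using Nat.le_induction with
  | base => norm_num
  | succ n hn ih => rw [pow_succ]; nlinarith

theorem mul_le_tower {s x y : ℕ} (hs : 2 ≤ s) (hx : x ≤ tower s) (hy : y ≤ tower s) :
    x * y ≤ tower (s + 1) :=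
  (Nat.mul_le_mul hx hy).trans (mul_self_le_two_pow (four_le_tower hs))

theorem add_le_tower {s x y : ℕ} (hs : 2 ≤ s) (hx : x ≤ tower s) (hy : y ≤ tower s) :
    x + y ≤ tower (s + 1) := by
  have := four_le_tower hs
  have := mul_le_tower hs le_rfl (le_refl (tower s))
  nlinarith

theorem pow_le_tower {s x y : ℕ} (hs : 2 ≤ s) (hx : x ≤ tower s) (hy : y ≤ tower s) :
    x ^ y ≤ tower (s + 2) := by
  calc x ^ y ≤ (2 ^ x) ^ y := Nat.pow_le_pow_left Nat.lt_two_pow_self.le y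
    _ = 2 ^ (x * y) := (pow_mul 2 x y).symm
    _ ≤ tower (s + 2) := Nat.pow_le_pow_right (by norm_num) (mul_le_tower hs hx hy)

theorem logStar_le_of_le_tower {n : ℕ} {x : ℝ} (hx : x ≤ tower n) : logStar x ≤ n := by
  have key : ∃ j ≤ n, (Real.logb 2)^[j] x ≤ 1 := by
    induction n generalizing x with
    | zero => exact ⟨0, le_rfl, by simpa [tower] using hx⟩
    | succ n ih =>
      rcases le_or_gt x 1 with h | h
      · exact ⟨0, Nat.zero_le _, h⟩
      have hl : Real.logb 2 x ≤ tower n := by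
        rw [Real.logb_le_iff_le_rpow (by norm_num) (by linarith), Real.rpow_natCast]
        simpa [tower] using hx
      obtain ⟨j, hj, hle⟩ := ih hl
      exact ⟨j + 1, by omega, by simpa using hle⟩
  obtain ⟨j, hj, hle⟩ := key
  exact (Nat.sInf_le hle).trans hj

theorem lt_logStar_of_tower_lt {n : ℕ} {x : ℝ} (hx : (tower n : ℝ) < x) : n < logStar x := by
  -- `logStar` is a least number of steps, so every earlier iterate has to be excluded, not only the
  -- n-th.
  have key : ∀ j ≤ n, 1 < (Real.logb 2)^[j] x := by
    induction n generalizing x with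
    | zero =>
      intro j hj
      obtain rfl : j = 0 := by omega
      simpa [tower] using hx
    | succ n ih =>
      have h1 : (1 : ℝ) ≤ tower (n + 1) := by exact_mod_cast one_le_tower _
      have hl : (tower n : ℝ) < Real.logb 2 x := by
        rw [Real.lt_logb_iff_rpow_lt (by norm_num) (by linarith), Real.rpow_natCast]
        simpa [tower] using hx
      intro j hj
      cases j with
      | zero => simpa using lt_of_le_of_lt h1 hx
      | succ j => simpa using ih hl j (by omega)
  by_contra! h
  exact absurd (Nat.sInf_mem (exists_iterate_logb_le_one x)) (not_le.2 (key _ h))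

theorem tendsto_logStar_one_div :
    Tendsto (fun ε : ℝ => logStar (1 / ε)) (𝓝[>] 0) atTop := by
  refine tendsto_atTop.2 fun n => ?_
  have h := (tendsto_inv_nhdsGT_zero (𝕜 := ℝ)).eventually (eventually_gt_atTop (tower n : ℝ))
  filter_upwards [h] with ε hε
  exact (lt_logStar_of_tower_lt (by simpa using hε)).le

/-- A function that is `o(log* (1 / ε))` is at some scale so small that a tower whose height is
linear in it does not reach `1 / ε`. -/
theorem exists_tower_lt_of_isLittleO {t : ℝ → ℕ}
    (ht : (fun ε : ℝ => (t ε : ℝ)) =o[𝓝[>] 0] (fun ε : ℝ => (logStar (1 / ε) : ℝ))) (a b : ℕ) :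
    ∃ ε : ℝ, 0 < ε ∧ ε < 1 ∧ (tower (a * t ε + b) : ℝ) < 1 / ε := by
  -- Half of log* is reserved for a t(ε), the other half for b.
  have h1 := ht.def (c := 1 / (2 * (a + 1))) (by positivity)
  have h2 := tendsto_logStar_one_div.eventually (eventually_gt_atTop (2 * b))
  have h3 : ∀ᶠ ε : ℝ in 𝓝[>] 0, ε < 1 := nhdsWithin_le_nhds (Iio_mem_nhds one_pos)
  obtain ⟨ε, h1, h2, h3, h0⟩ :=
    (h1.and (h2.and (h3.and (self_mem_nhdsWithin (a := (0 : ℝ)) (s := Set.Ioi 0))))).exists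
  refine ⟨ε, h0, h3, ?_⟩
  by_contra! h
  have hle := logStar_le_of_le_tower h
  simp only [Real.norm_natCast] at h1
  rw [div_mul_eq_mul_div, one_mul, le_div_iff₀ (by positivity)] at h1
  have h1' : t ε * (2 * (a + 1)) ≤ logStar (1 / ε) := by exact_mod_cast h1
  nlinarith

/-! ### A Ramsey theorem for finite sets, with a tower bound -/

universe u

/-- Every large set has a subset of size `m` in which the colour of a set does not depend on its
greatest element. -/
theorem exists_end_homogeneous (m : ℕ) : ∀ {κ : Type u} [Fintype κ] {K : ℕ}, 2 ≤ K →
    Fintype.card κ ≤ K → ∀ (χ : Finset ℕ → κ) (A : Finset ℕ), K ^ 4 ^ (m + 1) ≤ A.card →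
    ∃ B ⊆ A, B.card = m ∧ ∀ S ⊆ B, ∀ y ∈ B, ∀ z ∈ B, (∀ x ∈ S, x < y) → (∀ x ∈ S, x < z) →
      χ (insert y S) = χ (insert z S) := by
  classical
  induction m with
  | zero => intro κ _ K _ _ χ A _; exact ⟨∅, by simp, by simp, by simp⟩
  | succ m ih =>
    intro κ _ K hK hκ χ A hA
    set c := 4 ^ (m + 1) with hc
    have hc1 : 1 ≤ c := Nat.one_le_pow _ _ (by norm_num)
    -- Pigeonhole on the colours of singletons settles the case S = ∅. The fibre has one element to
    -- spare, which becomes the least element a.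
    have hcard : (Finset.univ : Finset κ).card * ((K ^ 2) ^ c + 1) ≤ A.card := by
      refine le_trans ?_ hA
      have h1 : 1 ≤ (K ^ 2) ^ c := Nat.one_le_pow _ _ (by positivity)
      calc (Finset.univ : Finset κ).card * ((K ^ 2) ^ c + 1)
          ≤ K * (K ^ (2 * c) * K) := by
            refine Nat.mul_le_mul hκ ?_
            rw [pow_mul]; nlinarith
        _ = K ^ (2 * c + 2) := by ring
        _ ≤ K ^ 4 ^ (m + 1 + 1) :=
            Nat.pow_le_pow_right (by omega) (by rw [pow_succ 4 (m + 1), ← hc]; omega)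
    obtain ⟨k₀, -, hk₀⟩ := Finset.exists_le_card_fiber_of_mul_le_card_of_maps_to
      (f := fun y => χ {y}) (fun _ _ => Finset.mem_univ _) ⟨χ ∅, Finset.mem_univ _⟩ hcard
    set A₁ := A.filter fun y => χ {y} = k₀ with hA₁
    have hne : A₁.Nonempty := Finset.card_pos.1 (by omega)
    set a := A₁.min' hne with ha
    have haA : a ∈ A₁ := Finset.min'_mem _ _
    -- Recording the colour of S both with and without a squares the number of colours; this is what
    -- the exponent 4 ^ (m + 1) pays for.
    obtain ⟨B, hBA, hB, hχ⟩ := ih (κ := κ × κ) (K := K ^ 2) (by nlinarith)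
      (by rw [Fintype.card_prod, sq]; exact Nat.mul_le_mul hκ hκ)
      (fun S => (χ S, χ (insert a S))) (A₁.erase a)
      (by rw [Finset.card_erase_of_mem haA]; omega)
    have hlt : ∀ y ∈ B, a < y := fun y hy =>
      lt_of_le_of_ne (Finset.min'_le _ _ (Finset.mem_of_mem_erase (hBA hy)))
        (Finset.ne_of_mem_erase (hBA hy)).symm
    have hsub : insert a B ⊆ A₁ :=
      Finset.insert_subset haA (hBA.trans (Finset.erase_subset _ _))
    refine ⟨insert a B, hsub.trans (Finset.filter_subset _ _), ?_, ?_⟩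
    · rw [Finset.card_insert_of_notMem fun h => lt_irrefl _ (hlt a h), hB]
    intro S hS y hy z hz hyS hzS
    rcases S.eq_empty_or_nonempty with rfl | ⟨x, hx⟩
    · have h : ∀ y ∈ insert a B, χ {y} = k₀ := fun y hy => (Finset.mem_filter.1 (hsub hy)).2
      simp [h y hy, h z hz]
    have hax : a ≤ x := by
      rcases Finset.mem_insert.1 (hS hx) with h | h
      · exact h.ge
      · exact (hlt x h).le
    have hyB : y ∈ B := (Finset.mem_insert.1 hy).resolve_left (hax.trans_lt (hyS x hx)).ne'
    have hzB : z ∈ B := (Finset.mem_insert.1 hz).resolve_left (hax.trans_lt (hzS x hx)).ne'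
    have h := hχ (S.erase a) (Finset.subset_insert_iff.1 hS) y hyB z hzB
      (fun x hx => hyS x (Finset.mem_of_mem_erase hx))
      (fun x hx => hzS x (Finset.mem_of_mem_erase hx))
    rw [Prod.mk.injEq] at h
    by_cases haS : a ∈ S
    · simpa only [Finset.insert_comm a, Finset.insert_erase haS] using h.2
    · simpa only [Finset.erase_eq_of_notMem haS] using h.1

/-- A bound for the Ramsey number of `k`-sets, `K` colours and homogeneous sets of size `M`. -/
def ramseyBound (K M : ℕ) : ℕ → ℕ
  | 0 => M
  | k + 1 => K ^ 4 ^ (ramseyBound K M k + 2)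

/-- In an end-homogeneous set B the greatest element of a (k+1)-set can be replaced by max B without
changing the colour. This reduces (k+1)-sets to k-sets of B without its maximum. -/
theorem exists_homogeneous {κ : Type u} [Fintype κ] {K : ℕ} (hK : 2 ≤ K)
    (hκ : Fintype.card κ ≤ K) (M k : ℕ) (χ : Finset ℕ → κ) (A : Finset ℕ)
    (hA : ramseyBound K M k ≤ A.card) :
    ∃ H ⊆ A, H.card = M ∧ ∃ c, ∀ S ⊆ H, S.card = k → χ S = c := by
  classical
  induction k generalizing χ A with
  | zero =>
    obtain ⟨H, hHA, hH⟩ := Finset.exists_subset_card_eq hA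
    exact ⟨H, hHA, hH, χ ∅, fun S _ hS => by rw [Finset.card_eq_zero.1 hS]⟩
  | succ k ih =>
    obtain ⟨B, hBA, hB, hχ⟩ := exists_end_homogeneous (ramseyBound K M k + 1) hK hκ χ A hA
    have hne : B.Nonempty := Finset.card_pos.1 (by omega)
    set y := B.max' hne with hy
    have hyB : y ∈ B := Finset.max'_mem _ _
    obtain ⟨H, hHB, hH, c, hc⟩ := ih (fun S => χ (insert y S)) (B.erase y)
      (by rw [Finset.card_erase_of_mem hyB]; omega)
    have hHB' : H ⊆ B := hHB.trans (Finset.erase_subset _ _)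
    refine ⟨H, hHB'.trans hBA, hH, c, fun S hS hSk => ?_⟩
    have hSne : S.Nonempty := Finset.card_pos.1 (by omega)
    set z := S.max' hSne with hz
    have hzS : z ∈ S := Finset.max'_mem _ _
    have hSe : S.erase z ⊆ H := (Finset.erase_subset _ _).trans hS
    rw [← hc (S.erase z) hSe (by rw [Finset.card_erase_of_mem hzS]; omega)]
    conv_lhs => rw [← Finset.insert_erase hzS]
    refine hχ _ (hSe.trans hHB') z (hHB' (hS hzS)) y hyB (fun x hx => ?_) fun x hx => ?_
    · exact lt_of_le_of_ne (Finset.le_max' _ _ (Finset.mem_of_mem_erase hx))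
        (Finset.ne_of_mem_erase hx)
    · exact lt_of_le_of_ne (Finset.le_max' _ _ (hHB' (hSe hx)))
        (Finset.ne_of_mem_erase (hHB (hSe hx)))

/-- Each step of the recursion costs five levels: one for adding 2, two for the power of 4 and two
for the power of K. -/
theorem ramseyBound_le_tower {K M s : ℕ} (hs : 2 ≤ s) (hK : K ≤ tower s) (hM : M ≤ tower s)
    (k : ℕ) : ramseyBound K M k ≤ tower (s + 5 * k) := by
  induction k with
  | zero => exact hM
  | succ k ih =>
    have h2 : 2 ≤ tower (s + 5 * k) := le_trans (by norm_num) (four_le_tower (by omega))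
    have h3 := add_le_tower (by omega) ih h2
    have h4 := pow_le_tower (x := 4) (by omega) (four_le_tower (by omega)) h3
    exact pow_le_tower (s := s + 5 * k + 1 + 2) (by omega) (hK.trans (tower_mono (by omega))) h4

/-! ### Balls -/

section Ball

variable {d : ℕ} {α : Type*}

theorem natAbs_le_of_mem_ball {r : ℕ} {u : Grid d} (hu : u ∈ ball d r) (i : Fin d) :
    (u i).natAbs ≤ r :=
  (Finset.single_le_sum (f := fun i => (u i).natAbs) (fun _ _ => Nat.zero_le _)
    (Finset.mem_univ i)).trans hu

theorem zero_mem_ball (d r : ℕ) : (0 : Grid d) ∈ ball d r := by simp [ball]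

theorem add_mem_ball {r s : ℕ} {u v : Grid d} (hu : u ∈ ball d r) (hv : v ∈ ball d s) :
    u + v ∈ ball d (r + s) := by
  have h : ∑ i, ((u + v) i).natAbs ≤ ∑ i, ((u i).natAbs + (v i).natAbs) :=
    Finset.sum_le_sum fun i _ => Int.natAbs_add_le _ _
  rw [Finset.sum_add_distrib] at h
  exact h.trans (Nat.add_le_add hu hv)

theorem ball_subset_Icc (d r : ℕ) : ball d r ⊆ Set.Icc (fun _ => -(r : ℤ)) fun _ => (r : ℤ) :=
  fun u hu => ⟨fun i => by have := natAbs_le_of_mem_ball hu i; dsimp only; omega,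
    fun i => by have := natAbs_le_of_mem_ball hu i; dsimp only; omega⟩

instance finite_ball (d r : ℕ) : Finite (ball d r) :=
  ((Set.finite_Icc _ _).subset (ball_subset_Icc d r)).to_subtype

theorem card_ball_le (d r : ℕ) : Nat.card (ball d r) ≤ (2 * r + 1) ^ d := by
  have h := Nat.card_mono (Set.finite_Icc _ _) (ball_subset_Icc d r)
  refine h.trans ?_
  rw [Nat.card_eq_fintype_card, Fintype.card_ofFinset, Pi.card_Icc]
  simp only [Int.card_Icc, Finset.prod_const, Finset.card_univ, Fintype.card_fin]
  exact Nat.pow_le_pow_left (by omega) d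

open Classical in
/-- The extension of a labelling of a ball to the grid by the label of the root. -/
noncomputable def extendBall {r : ℕ} (a : ball d r → α) (u : Grid d) : α :=
  if h : u ∈ ball d r then a ⟨u, h⟩ else a ⟨0, zero_mem_ball d r⟩

theorem extendBall_of_mem {r : ℕ} (a : ball d r → α) {u : Grid d} (h : u ∈ ball d r) :
    extendBall a u = a ⟨u, h⟩ := dif_pos h

theorem view_extendBall {r : ℕ} (a : ball d r → α) : view id r (extendBall a) 0 = a := by
  funext u
  simp [view, extendBall_of_mem a u.2]

theorem view_eq_view_of_le {r s : ℕ} (hrs : r ≤ s) {c c' : Grid d → α} {v v' : Grid d}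
    (h : view id s c v = view id s c' v') : view id r c v = view id r c' v' :=
  funext fun u => congrFun h ⟨u, le_trans (α := ℕ) u.2 hrs⟩

theorem view_translate {r : ℕ} (c : Grid d → α) (v : Grid d) :
    view id r c v = view id r (fun u => c (v + u)) 0 :=
  funext fun u => by simp [view]

end Ball

/-! ### Uniform algorithms that are stopped at a fixed radius -/

namespace UniformAlgorithm

variable {d : ℕ} {In Out : Type*} (A : UniformAlgorithm d In Out)

theorem exists_run_isSome_of_codingRadius_le {T : ℕ} {inp : Grid d → In}
    {x : Grid d → unitInterval} {v : Grid d} (h : A.codingRadius inp x v ≤ T) :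
    ∃ r ≤ T, (A.run inp x v r).isSome := by
  by_contra! hno
  have : ((T + 1 : ℕ) : ℕ∞) ≤ A.codingRadius inp x v := by
    refine le_sInf ?_
    rintro _ ⟨r, hr, rfl⟩
    by_contra hlt
    exact hno r (Nat.lt_succ_iff.1 (ENat.natCast_lt_natCast.1 (not_le.1 hlt))) hr
  have := this.trans h
  norm_cast at this
  omega

/-- Equal views of radius T make the two scans agree at every radius up to T, so they first stop at
the same radius. -/
theorem output_eq_of_view_eq {T : ℕ} {inp inp' : Grid d → In} {x x' : Grid d → unitInterval}
    {v v' : Grid d} (h : A.codingRadius inp x v ≤ T) (hinp : view id T inp v = view id T inp' v')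
    (hx : view id T x v = view id T x' v') : A.output inp x v = A.output inp' x' v' := by
  classical
  have hrun : ∀ r ≤ T, A.run inp x v r = A.run inp' x' v' r := fun r hr => by
    rw [run, run, view_eq_view_of_le hr hinp, view_eq_view_of_le hr hx]
  obtain ⟨r, hr, hsome⟩ := A.exists_run_isSome_of_codingRadius_le h
  have h₁ : ∃ r, (A.run inp x v r).isSome := ⟨r, hsome⟩
  have h₂ : ∃ r, (A.run inp' x' v' r).isSome := ⟨r, hrun r hr ▸ hsome⟩
  have hle : Nat.find h₁ ≤ T := (Nat.find_min' h₁ hsome).trans hr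
  have hfind : Nat.find h₂ = Nat.find h₁ := by
    rw [Nat.find_eq_iff]
    refine ⟨hrun _ hle ▸ Nat.find_spec h₁, fun n hn => ?_⟩
    rw [← hrun n (hn.le.trans hle)]
    exact Nat.find_min h₁ hn
  have e₁ : A.output inp x v = A.run inp x v (Nat.find h₁) := by
    rw [output, dif_pos h₁]
  have e₂ : A.output inp' x' v' = A.run inp' x' v' (Nat.find h₂) := by
    rw [output, dif_pos h₂]
  rw [e₁, e₂, hfind, hrun _ hle]

theorem codingRadius_translate (inp : Grid d → In) (x : Grid d → unitInterval) (v : Grid d) :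
    A.codingRadius inp x v = A.codingRadius (fun u => inp (v + u)) (fun u => x (v + u)) 0 := by
  have : ∀ r, A.run inp x v r = A.run (fun u => inp (v + u)) (fun u => x (v + u)) 0 r := by
    intro r
    rw [run, run, view_translate inp, view_translate x]
  simp only [codingRadius, this]

/-- The output of the algorithm, as far as the ball of radius `T` determines it. -/
noncomputable def localOutput [Nonempty Out] (T : ℕ) (a : ball d T → In)
    (y : ball d T → unitInterval) : Out :=
  (A.output (extendBall a) (extendBall y) 0).getD (Classical.arbitrary Out)

theorem localOutput_eq [Nonempty Out] {T : ℕ} {inp : Grid d → In} {x : Grid d → unitInterval}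
    {v : Grid d} {o : Out} (h : A.codingRadius inp x v ≤ T) (ho : A.output inp x v = some o) :
    A.localOutput T (view id T inp v) (view id T x v) = o := by
  rw [localOutput, ← A.output_eq_of_view_eq h (view_extendBall _).symm (view_extendBall _).symm,
    ho, Option.getD_some]

end UniformAlgorithm

/-! ### Invariance of the i.i.d. law and the union bound -/

instance (d : ℕ) : IsProbabilityMeasure (iid d) :=
  inferInstanceAs (IsProbabilityMeasure (Measure.infinitePi _))

theorem measurable_comp_right {d : ℕ} (α : Grid d → Grid d) :
    Measurable fun (x : Grid d → unitInterval) u => x (α u) :=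
  measurable_pi_lambda _ fun u => measurable_pi_apply (α u)

/-- Injective reindexing preserves the law of an independent, uniformly distributed labelling. -/
theorem iid_map_comp {d : ℕ} {α : Grid d → Grid d} (hα : Function.Injective α) :
    (iid d).map (fun x u => x (α u)) = iid d := by
  classical
  refine Measure.eq_infinitePi _ fun s t ht => ?_
  rw [Measure.map_apply (measurable_comp_right α)
    (MeasurableSet.pi s.countable_toSet fun i _ => ht i)]
  have h : (fun (x : Grid d → unitInterval) u => x (α u)) ⁻¹' Set.pi (s : Set (Grid d)) t =
      Set.pi (s.image α : Finset (Grid d)) fun v => t (Function.invFun α v) := by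
    ext x
    simp [Set.mem_pi, Function.leftInverse_invFun hα _]
  rw [h, iid, Measure.infinitePi_pi _ (fun v _ => ht _), Finset.prod_image fun _ _ _ _ h => hα h]
  simp [Function.leftInverse_invFun hα _]

/-- The inequality holds for arbitrary sets, so the failure events never have to be shown
measurable. -/
theorem iid_preimage_comp_le {d : ℕ} {α : Grid d → Grid d} (hα : Function.Injective α)
    (s : Set (Grid d → unitInterval)) :
    iid d ((fun x u => x (α u)) ⁻¹' s) ≤ iid d s :=
  (Measure.le_map_apply (measurable_comp_right α).aemeasurable s).trans_eq
    (by rw [iid_map_comp hα])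

namespace UniformAlgorithm

variable {d : ℕ} {In Out : Type*} {A : UniformAlgorithm d In Out}

/-- Moving v to the origin translates the reals, which preserves their law, and the input, which the
supremum in `tail` absorbs. -/
theorem measure_lt_codingRadius_le (A : UniformAlgorithm d In Out) (T : ℕ) (inp : Grid d → In)
    (v : Grid d) : iid d {x | (T : ℕ∞) < A.codingRadius inp x v} ≤ A.tail T := by
  simp only [A.codingRadius_translate inp _ v]
  exact (iid_preimage_comp_le (add_right_injective v)
    {x | (T : ℕ∞) < A.codingRadius (fun u => inp (v + u)) x 0}).trans
      (le_iSup (fun inp => iid d {x | (T : ℕ∞) < A.codingRadius inp x 0}) _)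

theorem Solves.nonempty_out [Nonempty In] {L : LCL d In Out} (hA : A.Solves L) :
    Nonempty Out := by
  obtain ⟨x, c, -⟩ := (hA fun _ => Classical.arbitrary In).exists
  exact ⟨c 0⟩

/-- The labels of the ball of radius `T` around `v` make the stopped algorithm locally correct
at the origin. -/
def GoodAtOrigin [Nonempty Out] (A : UniformAlgorithm d In Out) (L : LCL d In Out) (T : ℕ)
    (inp : Grid d → In) (x : Grid d → unitInterval) : Prop :=
  view id L.radius (fun w => (inp w, A.localOutput T (view id T inp w) (view id T x w))) 0 ∈
    L.allowed

/-- Outside a null set, failure at the origin forces some vertex of the constraint ball to have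
coding radius above T; otherwise stopped and true outputs agree on that ball. -/
theorem Solves.measure_not_goodAtOrigin_le [Nonempty Out] {L : LCL d In Out} (hA : A.Solves L)
    (T : ℕ) (inp : Grid d → In) :
    iid d {x | ¬ A.GoodAtOrigin L T inp x} ≤ Nat.card (ball d L.radius) * A.tail T := by
  have hsub : {x | ¬ A.GoodAtOrigin L T inp x} ⊆
      {x | ¬ ∃ c : Grid d → Out, (∀ v, A.output inp x v = some (c v)) ∧ L.IsColoring id inp c} ∪
        ⋃ v : ball d L.radius, {x | (T : ℕ∞) < A.codingRadius inp x v} := by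
    intro x hx
    by_contra hno
    rw [Set.mem_union, not_or, Set.mem_iUnion, not_exists] at hno
    obtain ⟨c, hc, hcol⟩ := not_not.1 hno.1
    have hr : ∀ v : ball d L.radius, A.codingRadius inp x v ≤ T := fun v => not_lt.1 (hno.2 v)
    refine hx ?_
    rw [GoodAtOrigin]
    convert hcol 0 using 1
    funext u
    simp only [view, id, zero_add, Prod.mk.injEq, true_and]
    exact A.localOutput_eq (hr u) (hc u)
  have := Fintype.ofFinite (ball d L.radius)
  calc iid d {x | ¬ A.GoodAtOrigin L T inp x}
      ≤ 0 + ∑ v : ball d L.radius, iid d {x | (T : ℕ∞) < A.codingRadius inp x v} := by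
        refine (measure_mono hsub).trans ((measure_union_le _ _).trans (add_le_add ?_ ?_))
        · exact (ae_iff.1 (hA inp)).le
        · exact measure_iUnion_fintype_le _ _
    _ ≤ ∑ _v : ball d L.radius, A.tail T := by
        rw [zero_add]
        exact Finset.sum_le_sum fun v _ => A.measure_lt_codingRadius_le T inp v
    _ = Nat.card (ball d L.radius) * A.tail T := by
        rw [Finset.sum_const, nsmul_eq_mul, Finset.card_univ, Nat.card_eq_fintype_card]

/-- The probabilistic method: if the tail is small, then one labelling of the identifiers by reals
makes the stopped algorithm locally correct for finitely many identifier assignments and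
inputs. -/
theorem Solves.exists_goodAtOrigin [Nonempty Out] {L : LCL d In Out} (hA : A.Solves L) (T : ℕ)
    {J : Type*} [Finite J] (α : J → Grid d → Grid d) (hα : ∀ j, Function.Injective (α j))
    (inp : J → Grid d → In)
    (hT : Nat.card J * (Nat.card (ball d L.radius) * A.tail T) < 1) :
    ∃ h : Grid d → unitInterval, ∀ j, A.GoodAtOrigin L T (inp j) fun u => h (α j u) := by
  have := Fintype.ofFinite J
  by_contra! hno
  have huniv : (⋃ j, {h : Grid d → unitInterval |
      ¬ A.GoodAtOrigin L T (inp j) fun u => h (α j u)}) = Set.univ :=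
    Set.eq_univ_of_forall fun h => Set.mem_iUnion.2 (hno h)
  have hle : iid d Set.univ ≤ Nat.card J * (Nat.card (ball d L.radius) * A.tail T) := by
    rw [← huniv]
    refine (measure_iUnion_fintype_le _ _).trans ?_
    rw [Nat.card_eq_fintype_card (α := J), ← Finset.card_univ, ← nsmul_eq_mul,
      ← Finset.sum_const]
    exact Finset.sum_le_sum fun j _ => (iid_preimage_comp_le (hα j)
      {x | ¬ A.GoodAtOrigin L T (inp j) x}).trans (hA.measure_not_goodAtOrigin_le T (inp j))
  rw [measure_univ] at hle
  exact absurd hT (not_lt.2 hle)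

end UniformAlgorithm

/-! ### Identifiers for hyperplanes -/

/-- The increasing enumeration of a finite set of natural numbers, with value `0` from its
cardinality on. -/
def enum (S : Finset ℕ) (j : ℕ) : ℕ :=
  if h : j < S.card then S.orderEmbOfFin rfl ⟨j, h⟩ else 0

theorem enum_mem {S : Finset ℕ} {j : ℕ} (h : j < S.card) : enum S j ∈ S := by
  rw [enum, dif_pos h]
  exact Finset.orderEmbOfFin_mem _ _ _

theorem enum_lt_enum {S : Finset ℕ} {i j : ℕ} (hij : i < j) (hj : j < S.card) :
    enum S i < enum S j := by
  rw [enum, enum, dif_pos (hij.trans hj), dif_pos hj]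
  exact (S.orderEmbOfFin rfl).strictMono hij

theorem enum_injOn {S : Finset ℕ} {i j : ℕ} (hi : i < S.card) (hj : j < S.card)
    (h : enum S i = enum S j) : i = j := by
  rcases lt_trichotomy i j with hlt | heq | hlt
  · exact absurd h (enum_lt_enum hlt hj).ne
  · exact heq
  · exact absurd h (enum_lt_enum hlt hi).ne'

theorem card_image_range {k : ℕ} {g : ℕ → ℕ} (hg : ∀ i j, i < j → j < k → g i < g j) :
    ((Finset.range k).image g).card = k := by
  rw [Finset.card_image_of_injOn, Finset.card_range]
  intro i hi j hj h
  simp only [Finset.coe_range, Set.mem_Iio] at hi hj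
  rcases lt_trichotomy i j with hlt | heq | hlt
  · exact absurd h (hg i j hlt hj).ne
  · exact heq
  · exact absurd h (hg j i hlt hi).ne'

theorem enum_image_range {k : ℕ} {g : ℕ → ℕ} (hg : ∀ i j, i < j → j < k → g i < g j) {j : ℕ}
    (hj : j < k) : enum ((Finset.range k).image g) j = g j := by
  have hcard := card_image_range hg
  rw [enum, dif_pos (by rwa [hcard])]
  exact (congrFun (Finset.orderEmbOfFin_unique
    (s := (Finset.range k).image g) rfl (f := fun i : Fin _ => g i)
    (fun i => Finset.mem_image_of_mem g (Finset.mem_range.2 (i.2.trans_eq hcard)))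
    (fun i i' h => hg i i' h (i'.2.trans_eq hcard))) ⟨j, by rwa [hcard]⟩).symm

/-- The identifiers of the vertices of the grid that a set `S` of `d * (2 * r + 1)` numbers below
`N` gives. The `i`-th coordinate names the hyperplane of the vertex that is orthogonal to the
`i`-th direction; near the origin these names are the elements of the `i`-th block of `S` in
increasing order. -/
def hyperplaneId {d : ℕ} (S : Finset ℕ) (N r : ℕ) (u : Grid d) : Grid d := fun i =>
  -- The two outer branches take values below -r and above N, away from the elements of S. They
  -- serve only to make the naming injective on the whole grid.
  if u i < -r then u i
  else if u i ≤ r then enum S (i * (2 * r + 1) + (u i + r).toNat) else N + u i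

theorem hyperplaneId_of_natAbs_le {d : ℕ} (S : Finset ℕ) (N : ℕ) {r : ℕ} {u : Grid d} {i : Fin d}
    (h : (u i).natAbs ≤ r) :
    hyperplaneId S N r u i = enum S (i * (2 * r + 1) + (u i + r).toNat) := by
  rw [hyperplaneId, if_neg (by omega), if_pos (by omega)]

theorem block_lt {d w i l : ℕ} (hi : i < d) (hl : l < w) : i * w + l < d * w := by
  calc i * w + l < i * w + w := by omega
    _ = (i + 1) * w := by ring
    _ ≤ d * w := Nat.mul_le_mul_right w hi

theorem hyperplaneId_injective {d N r : ℕ} {S : Finset ℕ} (hS : S.card = d * (2 * r + 1))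
    (hN : S ⊆ Finset.range N) :
    Function.Injective (hyperplaneId S N r : Grid d → Grid d) := by
  intro u v h
  funext i
  have hi := congrFun h i
  have hlt : ∀ {j : ℤ}, -r ≤ j → j ≤ r → i * (2 * r + 1) + (j + r).toNat < S.card :=
    fun h₁ h₂ => hS ▸ block_lt i.2 (by omega)
  have hmem : ∀ {j : ℤ}, -r ≤ j → j ≤ r → enum S (i * (2 * r + 1) + (j + r).toNat) < N :=
    fun h₁ h₂ => Finset.mem_range.1 (hN (enum_mem (hlt h₁ h₂)))
  simp only [hyperplaneId] at hi
  by_cases hu : -(r : ℤ) ≤ u i ∧ u i ≤ r <;> by_cases hv : -(r : ℤ) ≤ v i ∧ v i ≤ r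
  · rw [if_neg (by omega), if_pos hu.2, if_neg (by omega), if_pos hv.2, Nat.cast_inj] at hi
    have := enum_injOn (hlt hu.1 hu.2) (hlt hv.1 hv.2) hi
    omega
  · have := hmem hu.1 hu.2
    split_ifs at hi <;> omega
  · have := hmem hv.1 hv.2
    split_ifs at hi <;> omega
  · split_ifs at hi <;> omega

/-- The identifiers near a vertex close to the origin are again given by a set of numbers, a
subset of the original one. -/
theorem exists_hyperplaneId_translate {d N T t : ℕ} {S : Finset ℕ}
    (hS : S.card = d * (2 * (T + t) + 1)) {v : Grid d} (hv : v ∈ ball d t) :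
    ∃ S' ⊆ S, S'.card = d * (2 * T + 1) ∧ ∀ u ∈ ball d T,
      hyperplaneId S N (T + t) (v + u) = hyperplaneId S' N T u := by
  classical
  set w := 2 * T + 1 with hw
  set W := 2 * (T + t) + 1 with hW
  set o : ℕ → ℕ := fun i => if h : i < d then (v ⟨i, h⟩ + t).toNat else 0 with ho
  have hot : ∀ i, o i ≤ 2 * t := by
    intro i
    simp only [ho]
    split_ifs with h
    · have := natAbs_le_of_mem_ball hv ⟨i, h⟩
      omega
    · omega
  -- From each block of length W keep the window of length w that starts at offset v i + t. Listing
  -- the windows block by block gives increasing positions in S.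
  set pos : ℕ → ℕ := fun j => j / w * W + (o (j / w) + j % w) with hpos
  have hposlt : ∀ j < d * w, pos j < S.card := fun j hj => by
    have := Nat.mod_lt j (show 0 < w by omega)
    have := hot (j / w)
    rw [hS]
    exact block_lt ((Nat.div_lt_iff_lt_mul (by omega)).2 hj) (by omega)
  have hposmono : ∀ i j, i < j → pos i < pos j := by
    intro i j hij
    have hi := Nat.mod_lt i (show 0 < w by omega)
    have := hot (i / w)
    rcases (Nat.div_le_div_right (c := w) hij.le).eq_or_lt with h | h
    · have h₁ := Nat.div_add_mod i w
      have h₂ := Nat.div_add_mod j w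
      simp only [hpos, h] at h₁ ⊢
      omega
    · calc pos i < (i / w) * W + W := by simp only [hpos]; omega
        _ = (i / w + 1) * W := by ring
        _ ≤ j / w * W := Nat.mul_le_mul_right W h
        _ ≤ pos j := Nat.le_add_right _ _
  have hg : ∀ i j, i < j → j < d * w → enum S (pos i) < enum S (pos j) :=
    fun i j hij hj => enum_lt_enum (hposmono i j hij) (hposlt j hj)
  refine ⟨(Finset.range (d * w)).image fun j => enum S (pos j), ?_, card_image_range hg, ?_⟩
  · intro z hz
    obtain ⟨j, hj, rfl⟩ := Finset.mem_image.1 hz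
    exact enum_mem (hposlt j (Finset.mem_range.1 hj))
  intro u hu
  funext i
  have hui := natAbs_le_of_mem_ball hu i
  have hvi := natAbs_le_of_mem_ball hv i
  have hl : (u i + T).toNat < w := by omega
  rw [hyperplaneId_of_natAbs_le S N (by simp only [Pi.add_apply]; omega),
    hyperplaneId_of_natAbs_le _ N hui, ← hw, ← hW, enum_image_range hg (block_lt i.2 hl)]
  have hdiv : (i * w + (u i + T).toNat) / w = i := by
    rw [mul_comm, Nat.mul_add_div (by omega), Nat.div_eq_of_lt hl, add_zero]
  have hmod : (i * w + (u i + T).toNat) % w = (u i + T).toNat := by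
    rw [mul_comm, Nat.mul_add_mod, Nat.mod_eq_of_lt hl]
  simp only [hpos, hdiv, hmod, ho, dif_pos i.2, Fin.eta, Pi.add_apply]
  congr 3
  omega

/-! ### Rules that ignore the randomness -/

section Oblivious

variable {d : ℕ} {In Out : Type*}

/-- A rule of radius `T` that only looks at the inputs and solves the problem on the grid. -/
def LCL.IsObliviousRule (L : LCL d In Out) (T : ℕ) (F : (ball d T → In) → Out) : Prop :=
  ∀ inp : Grid d → In, view id L.radius (fun w => (inp w, F (view id T inp w))) 0 ∈ L.allowed

/-- A fixed h turns the stopped algorithm into a deterministic rule depending on a set of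
identifiers; Ramsey's theorem removes that dependence. -/
theorem UniformAlgorithm.Solves.exists_isObliviousRule [Finite In] [Nonempty Out] [Finite Out]
    {A : UniformAlgorithm d In Out} {L : LCL d In Out} (hA : A.Solves L) {T K N : ℕ}
    (hK : 2 ≤ K) (hcard : Nat.card ((ball d T → In) → Out) ≤ K)
    (hN : ramseyBound K (d * (2 * (T + L.radius) + 1)) (d * (2 * T + 1)) ≤ N)
    (hT : (2 ^ N * Nat.card (ball d (T + L.radius) → In) : ℕ) *
      (Nat.card (ball d L.radius) * A.tail T) < 1) :
    ∃ F, L.IsObliviousRule T F := by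
  classical
  set M := d * (2 * (T + L.radius) + 1) with hM
  -- The scenarios of the union bound: a candidate for the homogeneous set, and the inputs that the
  -- stopped algorithm can see from the constraint ball.
  let J := (Finset.range N).powersetCard M × (ball d (T + L.radius) → In)
  have hJ : Nat.card J ≤ 2 ^ N * Nat.card (ball d (T + L.radius) → In) := by
    rw [Nat.card_prod]
    refine Nat.mul_le_mul_right _ ?_
    rw [Nat.card_eq_fintype_card, Fintype.card_coe, Finset.card_powersetCard, Finset.card_range]
    exact Nat.choose_le_two_pow N M
  have hmem := fun S : (Finset.range N).powersetCard M => Finset.mem_powersetCard.1 S.2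
  obtain ⟨h, hgood⟩ := hA.exists_goodAtOrigin T (J := J)
    (fun j => hyperplaneId (j.1 : Finset ℕ) N (T + L.radius))
    (fun j => hyperplaneId_injective (hmem j.1).2 (hmem j.1).1)
    (fun j => extendBall j.2) (lt_of_le_of_lt (by gcongr) hT)
  have := Fintype.ofFinite ((ball d T → In) → Out)
  obtain ⟨S, hSN, hS, F, hF⟩ := exists_homogeneous hK (by rwa [← Nat.card_eq_fintype_card])
    M (d * (2 * T + 1))
    (fun (S : Finset ℕ) a => A.localOutput T a fun u => h (hyperplaneId S N T u))
    (Finset.range N) (by rwa [Finset.card_range])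
  refine ⟨F, fun inp => ?_⟩
  have key := hgood (⟨S, Finset.mem_powersetCard.2 ⟨hSN, hS⟩⟩,
    view id (T + L.radius) inp 0)
  simp only [UniformAlgorithm.GoodAtOrigin] at key
  have hext : ∀ u ∈ ball d (T + L.radius),
      extendBall (view id (T + L.radius) inp 0) u = inp u := fun u hu => by
    rw [extendBall_of_mem _ hu]; simp [view]
  convert key using 1
  funext v
  -- Each vertex of the constraint ball sees the names given by its own subset of S, of the size on
  -- which the colour is constantly F.
  obtain ⟨S', hS'S, hS', htr⟩ := exists_hyperplaneId_translate (N := N) hS v.2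
  have hv : (v : Grid d) ∈ ball d (T + L.radius) := by
    simpa using add_mem_ball (zero_mem_ball d T) v.2
  have hview : view id T (extendBall (view id (T + L.radius) inp 0)) v = view id T inp v :=
    funext fun u => hext _ (by rw [add_comm T]; exact add_mem_ball v.2 u.2)
  have hids : view id T (fun u => h (hyperplaneId S N (T + L.radius) u)) v =
      fun u : ball d T => h (hyperplaneId S' N T u) :=
    funext fun u => congrArg h (htr u u.2)
  simp only [view, id, zero_add, Prod.mk.injEq]
  refine ⟨(hext v hv).symm, ?_⟩
  rw [hview, hids, ← hF S' hS'S hS']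

/-- The constraint at v is the constraint at the origin of the grid for the input pulled back along
u ↦ v + π u, so additivity of π suffices. -/
theorem LCL.IsObliviousRule.isColoring {L : LCL d In Out} {T : ℕ} {F : (ball d T → In) → Out}
    (hF : L.IsObliviousRule T F) {V : Type*} [Add V] {π : Grid d → V}
    (hπ : ∀ v u w, v + π (u + w) = v + π u + π w) (inp : V → In) :
    L.IsColoring π inp fun v => F (view π T inp v) := by
  intro v
  convert hF fun u => inp (v + π u) using 1
  funext u
  have hview : view π T inp (v + π u) = view id T (fun u => inp (v + π u)) u :=
    funext fun w => by simp [view, hπ]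
  simp only [view, id, zero_add, ← hview]

theorem Torus.add_cover_add (s : Fin d → ℕ) (v : Torus s) (u w : Grid d) :
    v + Torus.cover s (u + w) = v + Torus.cover s u + Torus.cover s w :=
  funext fun i => by simp [Torus.cover, add_assoc]

theorem LCL.IsObliviousRule.inLOCAL {L : LCL d In Out} {T : ℕ} {F : (ball d T → In) → Out}
    (hF : L.IsObliviousRule T F) : L.InLOCAL fun _ => T :=
  fun _ => ⟨fun _ _ a => F a, fun _ s _ _ _ _ _ inp => hF.isColoring (Torus.add_cover_add s) inp⟩

theorem LCL.IsObliviousRule.isTrivial [Nonempty In] [Subsingleton In] {L : LCL d In Out} {T : ℕ}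
    {F : (ball d T → In) → Out} (hF : L.IsObliviousRule T F) : L.IsTrivial := by
  refine ⟨F fun _ => Classical.arbitrary In, fun inp => ?_⟩
  have h : L.IsColoring id inp fun v => F (view id T inp v) :=
    hF.isColoring (fun v u w => (add_assoc v u w).symm) inp
  rwa [show (fun v => F (view id T inp v)) = fun _ => F fun _ => Classical.arbitrary In from
    funext fun v => congrArg F (Subsingleton.elim _ _)] at h

end Oblivious

/-- The requirement on the tail is met as soon as `1 / ε` exceeds a tower whose height is linear
in the radius. -/
theorem exists_tower_bound (d t p q : ℕ) : ∃ a b : ℕ, ∀ T : ℕ,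
    2 ^ ramseyBound (q ^ p ^ (2 * T + 1) ^ d + 2) (d * (2 * (T + t) + 1)) (d * (2 * T + 1)) *
      p ^ (2 * (T + t) + 1) ^ d * (2 * t + 1) ^ d ≤ tower (a * T + b) := by
  refine ⟨12 * (d + 1), 12 * (d + 1) * (t + 1) + p + q + 40, fun T => ?_⟩
  -- All basic parameters are at most s. The later operations add boundedly many levels, except
  -- Ramsey's 5 d (2 T + 1); together with s the coefficient of T is 12 d + 2.
  set s := (2 * (T + t) + 1) * (d + 1) + p + q + 3 with hs
  have hle : ∀ x ≤ s, x ≤ tower s := fun x hx => hx.trans (le_tower s)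
  have mono : ∀ {x m n : ℕ}, x ≤ tower m → m ≤ n → x ≤ tower n :=
    fun h hmn => h.trans (tower_mono hmn)
  have hd : d ≤ tower s := hle _ (by rw [hs]; nlinarith)
  have hp : p ≤ tower s := hle _ (by omega)
  have hq : q ≤ tower s := hle _ (by omega)
  have ht : 2 * t + 1 ≤ tower s := hle _ (by rw [hs]; nlinarith)
  have hT : 2 * T + 1 ≤ tower s := hle _ (by rw [hs]; nlinarith)
  have hTt : 2 * (T + t) + 1 ≤ tower s := hle _ (by rw [hs]; nlinarith)
  have hM : d * (2 * (T + t) + 1) ≤ tower s := hle _ (by rw [hs]; nlinarith)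
  have h₁ := pow_le_tower (by omega) hT hd
  have h₂ := pow_le_tower (by omega) (mono hp (by omega)) h₁
  have h₃ := pow_le_tower (by omega) (mono hq (by omega)) h₂
  have h₄ := add_le_tower (y := 2) (by omega) h₃
    (by have := four_le_tower (s := s + 2 + 2 + 2) (by omega); omega)
  have h₅ := ramseyBound_le_tower (by omega) h₄ (mono hM (by omega)) (d * (2 * T + 1))
  set e := s + 2 + 2 + 2 + 1 + 5 * (d * (2 * T + 1)) with he
  have h₆ := pow_le_tower (x := 2) (by omega)
    ((by norm_num : 2 ≤ 4).trans (four_le_tower (by omega))) h₅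
  have h₇ := pow_le_tower (by omega) hTt hd
  have h₈ := pow_le_tower (by omega) (mono hp (by omega)) h₇
  have h₉ := mul_le_tower (by omega) h₆ (mono h₈ (by omega))
  have h₀ := mul_le_tower (by omega) h₉ (mono (pow_le_tower (by omega) ht hd) (by omega))
  refine mono h₀ ?_
  rw [he, hs]
  nlinarith

theorem exists_isObliviousRule_of_inULOCAL {d : ℕ} {In Out : Type*} [Finite In] [Nonempty In]
    [Finite Out] {L : LCL d In Out} {t : ℝ → ℕ}
    (ht : (fun ε : ℝ => (t ε : ℝ)) =o[𝓝[>] 0] (fun ε : ℝ => (logStar (1 / ε) : ℝ)))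
    (hL : L.InULOCAL t) : ∃ T F, L.IsObliviousRule T F := by
  obtain ⟨A, hA, htail⟩ := hL
  have := hA.nonempty_out
  have hp : 0 < Nat.card In := Nat.card_pos
  have hq : 0 < Nat.card Out := Nat.card_pos
  obtain ⟨a, b, hab⟩ := exists_tower_bound d L.radius (Nat.card In) (Nat.card Out)
  obtain ⟨ε, hε, hε1, hlt⟩ := exists_tower_lt_of_isLittleO ht a b
  -- The summand 2 only ensures that K ≥ 2, as the Ramsey bound requires.
  set K := Nat.card Out ^ Nat.card In ^ (2 * t ε + 1) ^ d + 2 with hK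
  set N := ramseyBound K (d * (2 * (t ε + L.radius) + 1)) (d * (2 * t ε + 1)) with hN
  have hcard : Nat.card ((ball d (t ε) → In) → Out) ≤ K := by
    rw [Nat.card_fun, Nat.card_fun]
    exact (Nat.pow_le_pow_right hq (Nat.pow_le_pow_right hp (card_ball_le d _))).trans
      (Nat.le_add_right _ 2)
  have hle : 2 ^ N * Nat.card (ball d (t ε + L.radius) → In) * Nat.card (ball d L.radius) ≤
      tower (a * t ε + b) := by
    refine le_trans ?_ (hab (t ε))
    rw [Nat.card_fun]
    exact Nat.mul_le_mul (Nat.mul_le_mul_left _ (Nat.pow_le_pow_right hp (card_ball_le d _)))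
      (card_ball_le d _)
  refine ⟨t ε, hA.exists_isObliviousRule (Nat.le_add_left 2 _) hcard hN.ge ?_⟩
  rw [← mul_assoc, ← Nat.cast_mul]
  calc _ ≤ (tower (a * t ε + b) : ENNReal) * ENNReal.ofReal ε :=
        mul_le_mul' (by exact_mod_cast hle) (htail ε hε hε1)
    _ = ENNReal.ofReal (tower (a * t ε + b) * ε) := by
        rw [ENNReal.ofReal_mul (by positivity), ENNReal.ofReal_natCast]
    _ < 1 := by
        rw [ENNReal.ofReal_lt_one]
        rwa [lt_div_iff₀ hε] at hlt

end GridLCL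

open GridLCL
theorem corollary3p2 {d : ℕ} (hd : 0 < d) {In Out : Type*} [Finite In] [Nonempty In] [Finite Out]
    (L : LCL d In Out)
    (hL : ∃ t : ℝ → ℕ,
      (fun ε : ℝ => (t ε : ℝ)) =o[𝓝[>] 0] (fun ε : ℝ => (logStar (1 / ε) : ℝ)) ∧ L.InULOCAL t) :
    (∃ f : ℕ → ℕ, (fun n : ℕ => (f n : ℝ)) =O[atTop] (fun _ : ℕ => (1 : ℝ)) ∧ L.InLOCAL f) ∧
      (Subsingleton In → L.IsTrivial) := by
  obtain ⟨t, ht, hL⟩ := hL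
  obtain ⟨T, F, hF⟩ := exists_isObliviousRule_of_inULOCAL ht hL
  exact ⟨⟨fun _ => T, isBigO_const_const _ one_ne_zero _, hF.inLOCAL⟩, fun _ => hF.isTrivial⟩
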